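/- Let $k\ge 2$. The language $\mathrm{PCF}\langle X_1,\dots,X_k\rangle$ has types $A::=\mathrm{Bool}\mid\mathbf N\mid A\to A$ and terms $$M::=\mathsf 0\mid \mathsf{succ}\,M\mid\mathsf{pred}\,M\mid\mathsf{ifz}(M,M,M)\mid x\mid\lambda x.M\mid MM\mid \mathrm Y M\mid M\oplus_{X_j}M\qquad(1\le j\le k),$$ with $\mathsf 1:=\mathsf{succ}\,\mathsf 0$. Typing is the usual one of PCF; moreover $\mathsf 0,\mathsf 1:\mathrm{Bool}$, every term of type $\mathrm{Bool}$ has type $\mathbf N$, and $M\oplus_{X_j}N:A$ whenever $M,N:A$. Terms are interpreted in the weighted relational semantics over the continuous semiring $\mathbb N^\infty\{\!\{\mathbb X\}\!\}$ of formal power series with coefficients in $\mathbb N^\infty=\mathbb N\cup\{\infty\}$ and variables $\mathbb X=\{X_1,\overline{X_1},\dots,X_k,\overline{X_k}\}$: one has $[\![\mathrm{Bool}]\!]=\{0,1\}$, $[\![\mathbf N]\!]=\mathbb N$, $[\![A\to B]\!]={!}[\![A]\!]\times[\![B]\!]$ (where $!$ denotes finite multisets), and a typing derivation of $\Gamma\vdash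 M:A$ is interpreted as a $[\![A]\!]$-indexed family of power series over $\mathbb N^\infty\{\!\{\mathbb X\}\!\}$ in the variables $[\![\Gamma]\!]$, with $[\![M\oplus_{X_j}N]\!]=X_j[\![M]\!]+\overline{X_j}[\![N]\!]$ and with $\mathrm Y$ interpreted by least fixpoints. In particular, a closed term $M:\mathrm{Bool}$ gives two power series $[\![M]\!]_0,[\![M]\!]_1\in\mathbb N^\infty\{\!\{\mathbb X\}\!\}$. Let $\mathbb T=[0,\infty]$ be the tropical semiring, with $\min$ as sum and $+$ as product (and $0\cdot\infty=0$). The tropicalization of a power series $s\in\mathbb N^\infty\{\!\{\mathbb X\}\!\}$ is the function $\mathsf t^!s:\mathbb T^{\mathbb X}\to\mathbb T$, $\mathsf t^!s(x)=\inf_{\mu\in\mathrm{supp}(s)}\sum_{a\in\mathbb X}\mu(a)x_a$. For $i\in\{0,1\}$ and a closed $M:\mathrm{Bool}$, the tropical degree $\mathfrak d_i(M)\in\mathbb N$ is the minimum degree of a tropical polynomial $p$ over $\mathbb T$ in the variables $\mathbb X$, all of whose coefficients are the $0$ or the $1$ of $\mathbb T$, such that $\mathrm{supp}(p)\subseteq\mathrm{supp}([\![M]\!]_i)$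 and such that the function $\mathbb T^{\mathbb X}\to\mathbb T$ defined by $p$ is $\mathsf t^![\![M]\!]_i$ (the zero polynomial has degree $0$). **Theorem.** Let $k\ge2$ and $i\in\{0,1\}$. Consider the following two decision problems, whose input is a number $d\in\mathbb N$ and (the Gödel number of) a closed term $M:\mathrm{Bool}$ of $\mathrm{PCF}\langle X_1,\dots,X_k\rangle$, given with a typing derivation: 1. is $\mathfrak d_i(M)<d$? 2. is $\mathfrak d_i(M)=d$? Neither problem is recursively enumerable, and both are $\Pi^0_1$-hard: every $\Pi^0_1$ set of natural numbers is many-one reducible, by a computable function, to each of them. -/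

import Mathlib

open scoped ENNReal

noncomputable section

namespace PCFX

/-! ### Syntax: the language `PCF⟨X₁,…,X_k⟩` -/

/-- Types `A ::= Bool | N | A → A`. -/
inductive Ty : Type
  | bool : Ty
  | nat : Ty
  | arr : Ty → Ty → Ty

/-- `Var Γ A`: a variable declared with type `A` in the context `Γ` (de Bruijn style). -/
inductive Var : List Ty → Ty → Type
  | here {Γ : List Ty} {A : Ty} : Var (A :: Γ) A
  | there {Γ : List Ty} {A B : Ty} : Var Γ A → Var (B :: Γ) A

/-- `Tm k Γ A`: terms (up to `α`-equivalence) with parameters `X₁,…,X_k`, together with a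
derivation of the judgement `Γ ⊢ M : A`. There is one constructor for each typing rule; the rule
`cast` is the inclusion of `Bool` in `N`. A closed term `M : Bool` is an element of
`Tm k [] Ty.bool`. -/
inductive Tm (k : ℕ) : List Ty → Ty → Type
  | zero {Γ : List Ty} : Tm k Γ Ty.nat
  | succ {Γ : List Ty} (M : Tm k Γ Ty.nat) : Tm k Γ Ty.nat
  | pred {Γ : List Ty} (M : Tm k Γ Ty.nat) : Tm k Γ Ty.nat
  | bool0 {Γ : List Ty} : Tm k Γ Ty.bool
  | bool1 {Γ : List Ty} : Tm k Γ Ty.bool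
  | cast {Γ : List Ty} (M : Tm k Γ Ty.bool) : Tm k Γ Ty.nat
  | var {Γ : List Ty} {A : Ty} (x : Var Γ A) : Tm k Γ A
  | lam {Γ : List Ty} {A B : Ty} (M : Tm k (A :: Γ) B) : Tm k Γ (Ty.arr A B)
  | app {Γ : List Ty} {A B : Ty} (M : Tm k Γ (Ty.arr A B)) (N : Tm k Γ A) : Tm k Γ B
  | ifz {Γ : List Ty} {A : Ty} (M : Tm k Γ Ty.nat) (N P : Tm k Γ A) : Tm k Γ A
  | choice {Γ : List Ty} {A : Ty} (i : Fin k) (M N : Tm k Γ A) : Tm k Γ A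
  | fix {Γ : List Ty} {A : Ty} (M : Tm k Γ (Ty.arr A A)) : Tm k Γ A

/-! ### Gödel numbering -/

/-- Gödel number of a type. -/
def Ty.code : Ty → ℕ
  | .bool => Nat.pair 0 0
  | .nat => Nat.pair 1 0
  | .arr A B => Nat.pair 2 (Nat.pair A.code B.code)

/-- The de Bruijn index of a variable. -/
def Var.code {Γ : List Ty} {A : Ty} : Var Γ A → ℕ
  | .here => 0
  | .there x => x.code + 1

/-- Gödel number of a typed term. -/
def Tm.code {k : ℕ} {Γ : List Ty} {A : Ty} : Tm k Γ A → ℕ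
  | .zero => Nat.pair 0 0
  | .succ M => Nat.pair 1 M.code
  | .pred M => Nat.pair 2 M.code
  | .bool0 => Nat.pair 3 0
  | .bool1 => Nat.pair 4 0
  | .cast M => Nat.pair 5 M.code
  | .var x => Nat.pair 6 x.code
  | .lam M => Nat.pair 7 M.code
  | .app (A := A) M N => Nat.pair 8 (Nat.pair A.code (Nat.pair M.code N.code))
  | .ifz M N P => Nat.pair 9 (Nat.pair M.code (Nat.pair N.code P.code))
  | .choice i M N => Nat.pair 10 (Nat.pair i (Nat.pair M.code N.code))
  | .fix M => Nat.pair 11 M.code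

theorem Ty.code_injective {A B : Ty} (h : A.code = B.code) : A = B := by
  induction A generalizing B with
  | bool => cases B <;> simp [Ty.code, Nat.pair_eq_pair] at h ⊢
  | nat => cases B <;> simp [Ty.code, Nat.pair_eq_pair] at h ⊢
  | arr A₁ A₂ ih₁ ih₂ =>
    cases B <;> simp [Ty.code, Nat.pair_eq_pair] at h ⊢
    exact ⟨ih₁ h.1, ih₂ h.2⟩

theorem Var.code_injective {Γ : List Ty} {A : Ty} {x y : Var Γ A} (h : x.code = y.code) :
    x = y := by
  induction x with
  | here => cases y <;> simp [Var.code] at h ⊢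
  | there x ih =>
    cases y <;> simp [Var.code] at h ⊢
    exact ih h

/-- Distinct typed terms (of the same type, in the same context) have distinct codes. -/
theorem Tm.code_injective {k : ℕ} {Γ : List Ty} {A : Ty} {M N : Tm k Γ A}
    (h : M.code = N.code) : M = N := by
  induction M with
  | zero => cases N <;> simp [Tm.code, Nat.pair_eq_pair] at h ⊢
  | succ M ih => cases N <;> simp [Tm.code, Nat.pair_eq_pair] at h ⊢; exact ih h
  | pred M ih => cases N <;> simp [Tm.code, Nat.pair_eq_pair] at h ⊢; exact ih h
  | bool0 => cases N <;> simp [Tm.code, Nat.pair_eq_pair] at h ⊢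
  | bool1 => cases N <;> simp [Tm.code, Nat.pair_eq_pair] at h ⊢
  | cast M ih => cases N <;> simp [Tm.code, Nat.pair_eq_pair] at h ⊢; exact ih h
  | var x =>
    cases N <;> simp [Tm.code, Nat.pair_eq_pair] at h ⊢; exact Var.code_injective h
  | lam M ih => cases N <;> simp [Tm.code, Nat.pair_eq_pair] at h ⊢; exact ih h
  | app M₁ M₂ ih₁ ih₂ =>
    cases N <;> simp [Tm.code, Nat.pair_eq_pair] at h
    obtain ⟨h₀, h₁, h₂⟩ := h
    obtain rfl := Ty.code_injective h₀
    rw [ih₁ h₁, ih₂ h₂]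
  | ifz M₁ M₂ M₃ ih₁ ih₂ ih₃ =>
    cases N <;> simp [Tm.code, Nat.pair_eq_pair] at h ⊢
    exact ⟨ih₁ h.1, ih₂ h.2.1, ih₃ h.2.2⟩
  | choice i M₁ M₂ ih₁ ih₂ =>
    cases N <;> simp [Tm.code, Nat.pair_eq_pair] at h ⊢
    exact ⟨Fin.ext h.1, ih₁ h.2.1, ih₂ h.2.2⟩
  | fix M ih => cases N <;> simp [Tm.code, Nat.pair_eq_pair] at h ⊢; exact ih h

/-! ### Parametric weighted relational semantics -/

/-- The interpretation of types: `⟦Bool⟧ = {0,1}`, `⟦N⟧ = ℕ`, `⟦A → B⟧ = !⟦A⟧ × ⟦B⟧`, where the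
finite multisets `!Σ` are the finitely supported functions `Σ → ℕ`. -/
def Pt : Ty → Type
  | .bool => Fin 2
  | .nat => ℕ
  | .arr A B => (Pt A →₀ ℕ) × Pt B

/-- The `2k` formal parameters: `(i, true)` stands for `X_i` and `(i, false)` for its companion
`X̄_i`. -/
abbrev Param (k : ℕ) : Type := Fin k × Bool

/-- The formal variables of the power series that interpret terms in context `Γ = A₁,…,A_n`:
the disjoint union of the parameters and of the sets `⟦A₁⟧, …, ⟦A_n⟧`. -/
def FVar (k : ℕ) : List Ty → Type
  | [] => Param k
  | A :: Γ => Pt A ⊕ FVar k Γ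

/-- A parameter as a formal variable in context `Γ`. -/
def FVar.param {k : ℕ} (p : Param k) : (Γ : List Ty) → FVar k Γ
  | [] => p
  | _ :: Γ => Sum.inr (FVar.param p Γ)

/-- The formal variable `x_a`, for `x : A` declared in `Γ` and `a ∈ ⟦A⟧`. -/
def Var.point (k : ℕ) {Γ : List Ty} {A : Ty} : Var Γ A → Pt A → FVar k Γ
  | .here, a => Sum.inl a
  | .there x, a => Sum.inr (x.point k a)

/-- Formal power series over the continuous semiring `ℕ∞`, with variables in `V`. -/
abbrev FPS (V : Type) : Type := MvPowerSeries V ℕ∞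

/-- Infinite sums of formal power series: coefficient by coefficient, the supremum in `ℕ∞` of the
finite partial sums. -/
def FPS.infSum {V ι : Type} (f : ι → FPS V) : FPS V :=
  fun ν => ⨆ s : Finset ι, ∑ j ∈ s, MvPowerSeries.coeff ν (f j)

/-- Pointwise suprema of sequences of formal power series. -/
def FPS.sup {V : Type} (f : ℕ → FPS V) : FPS V :=
  fun ν => ⨆ n, MvPowerSeries.coeff ν (f n)

/-- Application: `(f g)_b = ∑_{m ∈ !⟦A⟧} f_{(m,b)} · g^m`, with `g^m = ∏_a g_a ^ m(a)`. -/
def applySeries {V : Type} {A B : Ty} (f : Pt (Ty.arr A B) → FPS V) (g : Pt A → FPS V) :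
    Pt B → FPS V :=
  fun b => FPS.infSum fun m : Pt A →₀ ℕ => f (m, b) * m.prod fun a n => g a ^ n

/-- The approximants of the least fixpoint of `g ↦ f g`, starting from `0`. -/
def fixIter {V : Type} {A : Ty} (f : Pt (Ty.arr A A) → FPS V) : ℕ → Pt A → FPS V
  | 0 => fun _ => 0
  | n + 1 => applySeries f (fixIter f n)

/-- The parametric interpretation of (the typing derivation of) a term `Γ ⊢ M : A`: a
`⟦A⟧`-indexed family of formal power series over `ℕ∞`, in the parameters and the variables from
`⟦Γ⟧`. -/
def Tm.interp {k : ℕ} {Γ : List Ty} {A : Ty} : Tm k Γ A → Pt A → FPS (FVar k Γ)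
  | .zero => fun n : ℕ => if n = 0 then 1 else 0
  | .succ M => fun n : ℕ => match n with
    | 0 => 0
    | n + 1 => M.interp n
  | .pred M => fun n : ℕ => match n with
    | 0 => M.interp (0 : ℕ) + M.interp (1 : ℕ)
    | n + 1 => M.interp (n + 2 : ℕ)
  | .bool0 => fun b : Fin 2 => if b = 0 then 1 else 0
  | .bool1 => fun b : Fin 2 => if b = 1 then 1 else 0
  | .cast M => fun n : ℕ => if h : n < 2 then M.interp (⟨n, h⟩ : Fin 2) else 0
  | .var x => fun a => MvPowerSeries.X (x.point k a)
  | .lam M => fun mb ν => MvPowerSeries.coeff (Finsupp.sumElim mb.1 ν) (M.interp mb.2)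
  | .app M N => applySeries M.interp N.interp
  | .ifz M N P => fun a =>
      M.interp (0 : ℕ) * N.interp a + FPS.infSum fun n : ℕ => M.interp (n + 1 : ℕ) * P.interp a
  | .choice i M N => fun a =>
      MvPowerSeries.X (FVar.param (i, true) _) * M.interp a +
        MvPowerSeries.X (FVar.param (i, false) _) * N.interp a
  | .fix M => fun a => FPS.sup fun n => fixIter M.interp n a

/-- The series `⟦M⟧_i ∈ ℕ∞⟦X₁, X̄₁, …, X_k, X̄_k⟧`, for a closed term `M : Bool` and
`i ∈ {0,1}`. -/
def Tm.series {k : ℕ} (M : Tm k [] Ty.bool) (i : Fin 2) : FPS (Param k) := M.interp i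

/-! ### Tropicalization and tropical degree -/

/-- The tropical semiring: `[0,∞]` with `min` as sum and `+` as product. -/
abbrev Trop : Type := Tropical ℝ≥0∞

/-- The support of a formal power series. -/
def FPS.supp {V Q : Type} [Semiring Q] (s : MvPowerSeries V Q) : Set (V →₀ ℕ) :=
  {μ | MvPowerSeries.coeff μ s ≠ 0}

/-- The tropical analytic function `s^!` of a tropical power series `s`: it maps `x` to the
infinite tropical sum (that is, the infimum) of the `s_μ · x^μ`. -/
def evalTrop {V : Type} (s : MvPowerSeries V Trop) (x : V → Trop) : Trop :=
  Tropical.trop (⨅ μ : V →₀ ℕ,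
    Tropical.untrop (MvPowerSeries.coeff μ s * μ.prod fun a n => x a ^ n))

open Classical in
/-- The all-one tropical series with the same support as `s`. -/
def tropSeries {V : Type} (s : FPS V) : MvPowerSeries V Trop :=
  fun μ => if μ ∈ FPS.supp s then 1 else 0

/-- A tropical polynomial is all-one if its coefficients are the `0` or `1` of the semiring. -/
def AllOne {V : Type} (p : MvPolynomial V Trop) : Prop :=
  ∀ μ, p.coeff μ = 0 ∨ p.coeff μ = 1

/-- The degrees of the all-one tropical polynomials `p` such that `p^!` is the tropicalization
of `s`, and the support of `p` is contained in that of `s`. -/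
def degreeSet {V : Type} (s : FPS V) : Set ℕ :=
  {n | ∃ p : MvPolynomial V Trop, AllOne p ∧
    evalTrop (p : MvPowerSeries V Trop) = evalTrop (tropSeries s) ∧
    FPS.supp (p : MvPowerSeries V Trop) ⊆ FPS.supp s ∧ p.totalDegree = n}

/-- The tropical degree of `M` at `i`: the minimum of `degreeSet ⟦M⟧_i`, which is not empty by
`degreeSet_nonempty`. -/
def Tm.tropDegree {k : ℕ} (M : Tm k [] Ty.bool) (i : Fin 2) : ℕ := sInf (degreeSet (M.series i))

theorem evalTrop_anti {V : Type} (x : V → Trop) {μ ν : V →₀ ℕ} (h : μ ≤ ν) :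
    Tropical.untrop (μ.prod fun a n => x a ^ n) ≤
      Tropical.untrop (ν.prod fun a n => x a ^ n) := by
  obtain ⟨ρ, rfl⟩ := exists_add_of_le h
  rw [Finsupp.prod_add_index' (by simp) (by simp [pow_add]), Tropical.untrop_mul]
  exact le_self_add

/-- The minimum that defines the tropical degree exists. -/
theorem degreeSet_nonempty {V : Type} [Finite V] (s : FPS V) : (degreeSet s).Nonempty := by
  classical
  set S : Set (V →₀ ℕ) := {μ | Minimal (· ∈ FPS.supp s) μ} with hS
  have hfin : S.Finite :=
    (setOfPred_minimal_antichain (· ∈ FPS.supp s)).finite_of_wellQuasiOrdered wellQuasiOrdered_le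
  set p : MvPolynomial V Trop := ∑ μ ∈ hfin.toFinset, MvPolynomial.monomial μ 1 with hp
  have hc : ∀ μ, p.coeff μ = if μ ∈ S then 1 else 0 := by
    intro μ
    simp [hp, MvPolynomial.coeff_sum, MvPolynomial.coeff_monomial]
  refine ⟨p.totalDegree, p, ?_, ?_, ?_, rfl⟩
  · intro μ
    rw [hc]
    split_ifs <;> simp
  · funext x
    have hp' : ∀ μ, MvPowerSeries.coeff μ (p : MvPowerSeries V Trop) = if μ ∈ S then 1 else 0 :=
      fun μ => by rw [MvPolynomial.coeff_coe, hc]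
    have hs' : ∀ μ, MvPowerSeries.coeff μ (tropSeries s) =
        if μ ∈ FPS.supp s then 1 else 0 := fun μ => rfl
    unfold evalTrop
    congr 1
    apply le_antisymm
    · refine le_iInf fun μ => ?_
      rw [hs']
      split_ifs with hμ
      · obtain ⟨m, hm, hmin⟩ := exists_minimal_le_of_wellFoundedLT (· ∈ FPS.supp s) μ hμ
        refine (iInf_le _ m).trans ?_
        rw [hp', if_pos (show m ∈ S from hmin), one_mul, one_mul]
        exact evalTrop_anti x hm
      · simp
    · refine le_iInf fun μ => ?_
      rw [hp']
      split_ifs with hμ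
      · refine (iInf_le _ μ).trans ?_
        rw [hs', if_pos hμ.prop]
      · simp
  · intro μ hμ
    by_contra hcon
    apply hμ
    rw [MvPolynomial.coeff_coe, hc, if_neg fun h : μ ∈ S => hcon h.prop]

/-! ### Decision problems -/

/-- A decision problem, with instances `x : ι` presented to machines by their Gödel numbers
`code x`, is recursively enumerable: some semi-decision procedure is correct on all instances
(whatever it does on numbers that are not the code of an instance). -/
def ProblemRE {ι : Type} (code : ι → ℕ) (yes : ι → Prop) : Prop :=
  ∃ P : ℕ → Prop, REPred P ∧ ∀ x, P (code x) ↔ yes x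

/-- A decision problem is `Π⁰₁`-hard: every `Π⁰₁` set of natural numbers (that is, every set with
recursively enumerable complement) is many-one reducible to it by a computable function. -/
def ProblemPi01Hard {ι : Type} (code : ι → ℕ) (yes : ι → Prop) : Prop :=
  ∀ A : ℕ → Prop, REPred (fun n => ¬ A n) →
    ∃ f : ℕ → ι, Computable (fun n => code (f n)) ∧ ∀ n, A n ↔ yes (f n)

/-- The Gödel number of an instance: a number `d` and a closed term `M : Bool`. -/
def instanceCode {k : ℕ} (x : ℕ × Tm k [] Ty.bool) : ℕ := Nat.pair x.1 x.2.code

end PCFX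

end

noncomputable section

namespace PCFX

/-! ### Boolean evaluation of power series -/

/-! Both problems are reached from the complement of an r.e. predicate `q` by one construction.
Suppose `T` is a closed term whose series at `i` is nonzero exactly when `q` holds and which, in
that case, contains a parameter-free monomial. The term `gadget j i T` has series `X + X̄² · ⟦T⟧_i`
at `i`. If `q` fails, this is the single monomial `X`, of tropical degree 1. If `q` holds, some
monomial of the support avoids `X`; making `X` infinite and the other parameters finite shows that
every representing polynomial needs a monomial without `X`, and these all have degree at least 2. So
the degree is 1, equivalently less than 2, exactly when `q` fails (`sInf_degreeSet_of_linear`,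
`tropDegree_gadget`). Failure of recursive enumerability follows from hardness by way of the halting
problem.

To build `T` (`exists_semidecision`), only supports matter. Since `ℕ∞` is positive and has no zero
divisors, `Holds` turns sums, products and suprema of series into disjunctions, conjunctions and
existentials. The semantics thus collapses to sets of points, where β-reduction and recursion can be
computed by hand. There primitive recursive functions are programmed (`definable_of_primrec'`), then
unbounded search for a halting time (`exists_search`). -/

/-- The value of a power series in the Boolean semiring: some monomial of the support of `s` only
involves variables that are true under `ρ`. -/
def Holds {V : Type} (s : FPS V) (ρ : V → Prop) : Prop :=
  ∃ ν, MvPowerSeries.coeff ν s ≠ 0 ∧ ∀ v, ν v ≠ 0 → ρ v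

section Holds

variable {V : Type} {ρ : V → Prop}

theorem Holds.mono {s : FPS V} {σ : V → Prop} (h : Holds s ρ) (hρ : ∀ v, ρ v → σ v) :
    Holds s σ :=
  let ⟨ν, h₁, h₂⟩ := h
  ⟨ν, h₁, fun v hv => hρ v (h₂ v hv)⟩

theorem not_holds_zero : ¬ Holds (0 : FPS V) ρ := by
  rintro ⟨ν, h, -⟩
  simp at h

theorem holds_one : Holds (1 : FPS V) ρ :=
  ⟨0, by simp, by simp⟩

theorem holds_X (v : V) : Holds (MvPowerSeries.X v : FPS V) ρ ↔ ρ v := by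
  classical
  constructor
  · rintro ⟨ν, h, hν⟩
    rw [MvPowerSeries.coeff_X] at h
    obtain rfl : ν = Finsupp.single v 1 := by
      by_contra hne
      simp [hne] at h
    exact hν v (by simp)
  · intro h
    refine ⟨Finsupp.single v 1, by simp [MvPowerSeries.coeff_X], fun w hw => ?_⟩
    obtain rfl : v = w := by
      by_contra hne
      simp [hne] at hw
    exact h

theorem holds_add {s t : FPS V} : Holds (s + t) ρ ↔ Holds s ρ ∨ Holds t ρ := by
  constructor
  · rintro ⟨ν, h, hν⟩
    rw [map_add, Ne, add_eq_zero, not_and_or] at h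
    exact h.imp (fun h => ⟨ν, h, hν⟩) (fun h => ⟨ν, h, hν⟩)
  · rintro (⟨ν, h, hν⟩ | ⟨ν, h, hν⟩) <;> exact ⟨ν, by simp [h], hν⟩

/-- Nothing cancels in `ℕ∞` and it has no zero divisors, so the support of a product is the full
sumset. -/
theorem mem_supp_mul {s t : FPS V} {ν : V →₀ ℕ} :
    ν ∈ FPS.supp (s * t) ↔ ∃ α ∈ FPS.supp s, ∃ β ∈ FPS.supp t, α + β = ν := by
  classical
  simp only [FPS.supp, Set.mem_ofPred_eq, MvPowerSeries.coeff_mul, Ne, Finset.sum_eq_zero_iff,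
    Prod.forall, mul_eq_zero]
  push Not
  constructor
  · rintro ⟨α, β, h, hα, hβ⟩
    exact ⟨α, hα, β, hβ, Finset.HasAntidiagonal.mem_antidiagonal.1 h⟩
  · rintro ⟨α, hα, β, hβ, h⟩
    exact ⟨α, β, Finset.HasAntidiagonal.mem_antidiagonal.2 h, hα, hβ⟩

theorem holds_mul {s t : FPS V} : Holds (s * t) ρ ↔ Holds s ρ ∧ Holds t ρ := by
  constructor
  · rintro ⟨ν, h, hν⟩
    obtain ⟨α, hα, β, hβ, rfl⟩ := mem_supp_mul.1 h
    exact ⟨⟨α, hα, fun v hv => hν v (by simp [hv])⟩, ⟨β, hβ, fun v hv => hν v (by simp [hv])⟩⟩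
  · rintro ⟨⟨α, hα, hα'⟩, ⟨β, hβ, hβ'⟩⟩
    refine ⟨α + β, mem_supp_mul.2 ⟨α, hα, β, hβ, rfl⟩, fun v hv => ?_⟩
    by_cases h : α v = 0
    · exact hβ' v (by simpa [h] using hv)
    · exact hα' v h

theorem holds_pow {s : FPS V} {n : ℕ} (hn : n ≠ 0) : Holds (s ^ n) ρ ↔ Holds s ρ := by
  induction n with
  | zero => exact absurd rfl hn
  | succ n ih =>
    rw [pow_succ, holds_mul]
    rcases eq_or_ne n 0 with rfl | h
    · simp [holds_one]
    · rw [ih h, and_self]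

theorem holds_prod {ι : Type} (t : Finset ι) (f : ι → FPS V) :
    Holds (∏ j ∈ t, f j) ρ ↔ ∀ j ∈ t, Holds (f j) ρ := by
  classical
  induction t using Finset.induction_on with
  | empty => simp [holds_one]
  | insert a t ha ih => rw [Finset.prod_insert ha, holds_mul, ih, Finset.forall_mem_insert]

theorem holds_infSum {ι : Type} (f : ι → FPS V) :
    Holds (FPS.infSum f) ρ ↔ ∃ j, Holds (f j) ρ := by
  have key : ∀ ν, MvPowerSeries.coeff ν (FPS.infSum f) ≠ 0 ↔
      ∃ j, MvPowerSeries.coeff ν (f j) ≠ 0 := by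
    intro ν
    have h : MvPowerSeries.coeff ν (FPS.infSum f) =
        ⨆ s : Finset ι, ∑ j ∈ s, MvPowerSeries.coeff ν (f j) := rfl
    rw [h, Ne, ENat.iSup_eq_zero]
    push Not
    constructor
    · rintro ⟨s, hs⟩
      obtain ⟨j, -, hj⟩ := Finset.exists_ne_zero_of_sum_ne_zero hs
      exact ⟨j, hj⟩
    · rintro ⟨j, hj⟩
      exact ⟨{j}, by simpa using hj⟩
  constructor
  · rintro ⟨ν, h, hν⟩
    obtain ⟨j, hj⟩ := (key ν).1 h
    exact ⟨j, ν, hj, hν⟩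
  · rintro ⟨j, ν, hj, hν⟩
    exact ⟨ν, (key ν).2 ⟨j, hj⟩, hν⟩

theorem holds_sup (f : ℕ → FPS V) : Holds (FPS.sup f) ρ ↔ ∃ n, Holds (f n) ρ := by
  have key : ∀ ν, MvPowerSeries.coeff ν (FPS.sup f) ≠ 0 ↔
      ∃ n, MvPowerSeries.coeff ν (f n) ≠ 0 := by
    intro ν
    have h : MvPowerSeries.coeff ν (FPS.sup f) = ⨆ n, MvPowerSeries.coeff ν (f n) := rfl
    rw [h, Ne, ENat.iSup_eq_zero]
    push Not
    rfl
  constructor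
  · rintro ⟨ν, h, hν⟩
    obtain ⟨j, hj⟩ := (key ν).1 h
    exact ⟨j, ν, hj, hν⟩
  · rintro ⟨j, ν, hj, hν⟩
    exact ⟨ν, (key ν).2 ⟨j, hj⟩, hν⟩

end Holds

/-! ### The Boolean collapse of the semantics -/

/-- Application of sets of points. -/
def SetApp {A B : Ty} (F : Pt (Ty.arr A B) → Prop) (G : Pt A → Prop) (b : Pt B) : Prop :=
  ∃ m : Pt A →₀ ℕ, F (m, b) ∧ ∀ a, m a ≠ 0 → G a

/-- The approximants of the least fixpoint of `SetApp F`. -/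
def SetIter {A : Ty} (F : Pt (Ty.arr A A) → Prop) : ℕ → Pt A → Prop
  | 0 => fun _ => False
  | n + 1 => SetApp F (SetIter F n)

/-- The environment that extends `ρ` with a set of points for a new variable. -/
def envCons {k : ℕ} {Γ : List Ty} {A : Ty} (G : Pt A → Prop) (ρ : FVar k Γ → Prop) :
    FVar k (A :: Γ) → Prop :=
  fun v => Sum.elim G ρ v

/-- The set of points of a term in an environment. -/
def Tm.sem {k : ℕ} {Γ : List Ty} {A : Ty} (M : Tm k Γ A) (ρ : FVar k Γ → Prop) (a : Pt A) : Prop :=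
  Holds (M.interp a) ρ

/-- Positive powers are idempotent in the Boolean semiring, so the multiset `m` counts only through
its support. -/
theorem holds_applySeries {V : Type} {A B : Ty} {f : Pt (Ty.arr A B) → FPS V} {g : Pt A → FPS V}
    {b : Pt B} {ρ : V → Prop} :
    Holds (applySeries f g b) ρ ↔ SetApp (fun p => Holds (f p) ρ) (fun a => Holds (g a) ρ) b := by
  rw [applySeries, holds_infSum]
  refine exists_congr fun m => ?_
  rw [holds_mul, Finsupp.prod, holds_prod]
  refine and_congr Iff.rfl (forall_congr' fun a => ?_)
  rw [Finsupp.mem_support_iff]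
  exact imp_congr_right fun h => holds_pow h

section Sem

variable {k : ℕ} {Γ : List Ty} {A B : Ty} {ρ : FVar k Γ → Prop}

theorem Tm.sem_mono {M : Tm k Γ A} {σ : FVar k Γ → Prop} {a : Pt A} (h : M.sem ρ a)
    (hρ : ∀ v, ρ v → σ v) : M.sem σ a :=
  Holds.mono h hρ

theorem envCons_mono {G H : Pt A → Prop} (h : ∀ a, G a → H a) :
    ∀ v, envCons G ρ v → envCons H ρ v := by
  rintro (a | v) hv
  · exact h a hv
  · exact hv

theorem sem_var {x : Var Γ A} {a : Pt A} : (Tm.var (k := k) x).sem ρ a ↔ ρ (x.point k a) :=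
  holds_X _

theorem sem_zero {n : ℕ} : (Tm.zero (k := k) (Γ := Γ)).sem ρ n ↔ n = 0 := by
  unfold Tm.sem Tm.interp
  by_cases h : n = 0 <;> simp [h, holds_one, not_holds_zero]

theorem sem_succ {M : Tm k Γ Ty.nat} {n : ℕ} :
    M.succ.sem ρ n ↔ ∃ m : ℕ, M.sem ρ m ∧ n = m + 1 := by
  unfold Tm.sem
  cases n with
  | zero => simpa [Tm.interp] using not_holds_zero
  | succ n =>
    constructor
    · intro h
      exact ⟨n, h, rfl⟩
    · rintro ⟨m, h, hm⟩
      obtain rfl : n = m := by omega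
      exact h

theorem sem_pred {M : Tm k Γ Ty.nat} {n : ℕ} :
    M.pred.sem ρ n ↔ ∃ m : ℕ, M.sem ρ m ∧ n = m - 1 := by
  unfold Tm.sem
  cases n with
  | zero =>
    refine (holds_add (s := M.interp (0 : ℕ)) (t := M.interp (1 : ℕ))).trans ?_
    constructor
    · rintro (h | h)
      · exact ⟨0, h, rfl⟩
      · exact ⟨1, h, rfl⟩
    · rintro ⟨m, h, hm⟩
      obtain rfl | rfl : m = 0 ∨ m = 1 := by omega
      · exact Or.inl h
      · exact Or.inr h
  | succ n =>
    constructor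
    · intro h
      exact ⟨n + 2, h, rfl⟩
    · rintro ⟨m, h, hm⟩
      obtain rfl : m = n + 2 := by omega
      exact h

theorem sem_ifz {M : Tm k Γ Ty.nat} {N P : Tm k Γ A} {a : Pt A} :
    (Tm.ifz M N P).sem ρ a ↔
      (M.sem ρ (0 : ℕ) ∧ N.sem ρ a) ∨ ((∃ n : ℕ, M.sem ρ (n + 1 : ℕ)) ∧ P.sem ρ a) := by
  unfold Tm.sem
  rw [Tm.interp, holds_add, holds_mul, holds_infSum]
  simp only [holds_mul, exists_and_right]

theorem sem_app {M : Tm k Γ (Ty.arr A B)} {N : Tm k Γ A} {b : Pt B} :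
    (Tm.app M N).sem ρ b ↔ SetApp (M.sem ρ) (N.sem ρ) b :=
  holds_applySeries

/-- The β-law: a monomial of the body splits uniquely into its part in the bound variable, which is
the multiset `m`, and its part in the context. -/
theorem setApp_sem_lam {M : Tm k (A :: Γ) B} {G : Pt A → Prop} {b : Pt B} :
    SetApp (M.lam.sem ρ) G b ↔ M.sem (envCons G ρ) b := by
  constructor
  · rintro ⟨m, ⟨ν, hν, hρ⟩, hm⟩
    refine ⟨Finsupp.sumElim m ν, hν, ?_⟩
    rintro (a | v) hv
    · exact hm a hv
    · exact hρ v hv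
  · rintro ⟨ν, hν, hρ⟩
    have hs : Finsupp.sumElim (ν.comapDomain Sum.inl Sum.inl_injective.injOn)
        (ν.comapDomain Sum.inr Sum.inr_injective.injOn) = ν :=
      Finsupp.comapDomain_sumElim_comapDomain ..
    refine ⟨ν.comapDomain Sum.inl Sum.inl_injective.injOn,
      ⟨ν.comapDomain Sum.inr Sum.inr_injective.injOn, ?_, fun v hv => hρ (Sum.inr v) hv⟩,
      fun a ha => hρ (Sum.inl a) ha⟩
    change MvPowerSeries.coeff (Finsupp.sumElim (ν.comapDomain Sum.inl Sum.inl_injective.injOn)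
        (ν.comapDomain Sum.inr Sum.inr_injective.injOn)) (M.interp b) ≠ 0
    rw [hs]
    exact hν

theorem sem_app_lam {M : Tm k (A :: Γ) B} {N : Tm k Γ A} {b : Pt B} :
    (Tm.app M.lam N).sem ρ b ↔ M.sem (envCons (N.sem ρ) ρ) b :=
  sem_app.trans setApp_sem_lam

theorem sem_fix {M : Tm k Γ (Ty.arr A A)} {a : Pt A} :
    M.fix.sem ρ a ↔ ∃ n, SetIter (M.sem ρ) n a := by
  have h : ∀ n a, Holds (fixIter M.interp n a) ρ ↔ SetIter (M.sem ρ) n a := by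
    intro n
    induction n with
    | zero => exact fun a => iff_of_false not_holds_zero id
    | succ n ih =>
      intro a
      refine holds_applySeries.trans ?_
      simp only [ih]
      rfl
  exact (holds_sup _).trans (exists_congr fun n => h n a)

/-- Semantics of a recursive function `Y (λ f. λ y. M)` applied to an argument. -/
theorem sem_app_fix_lam_lam {M : Tm k (A :: Ty.arr A B :: Γ) B} {N : Tm k Γ A} {b : Pt B} :
    (Tm.app (Tm.fix (Tm.lam (Tm.lam M))) N).sem ρ b ↔
      ∃ n, SetApp (SetIter (M.lam.lam.sem ρ) n) (N.sem ρ) b := by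
  rw [sem_app]
  constructor
  · rintro ⟨m, h, hm⟩
    obtain ⟨n, hn⟩ := sem_fix.1 h
    exact ⟨n, m, hn, hm⟩
  · rintro ⟨n, m, hn, hm⟩
    exact ⟨m, sem_fix.2 ⟨n, hn⟩, hm⟩

theorem not_setApp_setIter_zero {F : Pt (Ty.arr (Ty.arr A B) (Ty.arr A B)) → Prop} {G : Pt A → Prop}
    {b : Pt B} : ¬ SetApp (SetIter F 0) G b := by
  rintro ⟨m, h, -⟩
  exact h

theorem setApp_setIter_succ {M : Tm k (A :: Ty.arr A B :: Γ) B} {G : Pt A → Prop} {b : Pt B}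
    {n : ℕ} : SetApp (SetIter (M.lam.lam.sem ρ) (n + 1)) G b ↔
      M.sem (envCons G (envCons (SetIter (M.lam.lam.sem ρ) n) ρ)) b := by
  rw [← setApp_sem_lam]
  refine exists_congr fun m => and_congr ?_ Iff.rfl
  exact setApp_sem_lam

end Sem

end PCFX
end

noncomputable section

namespace PCFX

/-! ### Primitive recursive functions are definable -/

/-- The environment `ρ` assigns the numbers `v` to the variables `xs`. -/
def Assigns {k : ℕ} {Γ : List Ty} {n : ℕ} (ρ : FVar k Γ → Prop) (xs : Fin n → Var Γ Ty.nat)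
    (v : List.Vector ℕ n) : Prop :=
  ∀ (j : Fin n) (a : ℕ), ρ ((xs j).point k a) ↔ a = v.get j

/-- A numerical function is definable by a term in `n` given variables of type `N`. -/
def Definable (k : ℕ) {n : ℕ} (f : List.Vector ℕ n → ℕ) : Prop :=
  ∀ (Γ : List Ty) (xs : Fin n → Var Γ Ty.nat), ∃ M : Tm k Γ Ty.nat, ∀ ρ v, Assigns ρ xs v →
    ∀ a : ℕ, M.sem ρ a ↔ a = f v

/-- A numerical function of two groups of arguments is definable. -/
def Definable₂ (k : ℕ) {m n : ℕ} (f : List.Vector ℕ m → List.Vector ℕ n → ℕ) : Prop :=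
  ∀ (Γ : List Ty) (xs : Fin m → Var Γ Ty.nat) (ys : Fin n → Var Γ Ty.nat), ∃ M : Tm k Γ Ty.nat,
    ∀ ρ v w, Assigns ρ xs v → Assigns ρ ys w → ∀ a : ℕ, M.sem ρ a ↔ a = f v w

variable {k : ℕ} {Γ : List Ty}

theorem Assigns.there {A : Ty} {n : ℕ} {ρ : FVar k Γ → Prop} {xs : Fin n → Var Γ Ty.nat}
    {v : List.Vector ℕ n} (h : Assigns ρ xs v) (G : Pt A → Prop) :
    Assigns (envCons G ρ) (fun j => (xs j).there) v :=
  h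

theorem Assigns.cons {n : ℕ} {ρ : FVar k Γ → Prop} {x : Var Γ Ty.nat} {xs : Fin n → Var Γ Ty.nat}
    {b : ℕ} {v : List.Vector ℕ n} (hx : ∀ a : ℕ, ρ (x.point k a) ↔ a = b) (h : Assigns ρ xs v) :
    Assigns ρ (Fin.cons x xs : Fin (n + 1) → Var Γ Ty.nat) (b ::ᵥ v) := by
  intro j
  refine Fin.cases ?_ (fun j => ?_) j
  · simpa using hx
  · simpa using h j

/-- The arguments `g j v` are bound one at a time by β-redexes, hence the induction on `n`. Keeping
`v` as a separate group leaves it available to the remaining `g j`. -/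
theorem Definable₂.subst {m n : ℕ} {g : Fin n → List.Vector ℕ m → ℕ}
    (hg : ∀ j, Definable k (g j)) {f : List.Vector ℕ m → List.Vector ℕ n → ℕ}
    (hf : Definable₂ k f) : Definable k fun v => f v (List.Vector.ofFn fun j => g j v) := by
  induction n with
  | zero =>
    intro Γ xs
    obtain ⟨M, hM⟩ := hf Γ xs Fin.elim0
    exact ⟨M, fun ρ v hv => hM ρ v _ hv fun j => j.elim0⟩
  | succ n ih =>
    refine ih (fun j => hg j.succ) (f := fun v w => f v (g 0 v ::ᵥ w)) ?_
    intro Γ xs ys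
    obtain ⟨G, hG⟩ := hg 0 Γ xs
    obtain ⟨M, hM⟩ := hf (Ty.nat :: Γ) (fun j => (xs j).there)
      (Fin.cons Var.here fun j => (ys j).there)
    exact ⟨Tm.app M.lam G, fun ρ v w hv hw a => sem_app_lam.trans
      (hM _ v (g 0 v ::ᵥ w) (hv.there _) (Assigns.cons (hG ρ v hv) (hw.there _)) a)⟩

theorem Definable.comp {m n : ℕ} {f : List.Vector ℕ n → ℕ} {g : Fin n → List.Vector ℕ m → ℕ}
    (hf : Definable k f) (hg : ∀ j, Definable k (g j)) :
    Definable k fun v => f (List.Vector.ofFn fun j => g j v) := by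
  refine Definable₂.subst hg (f := fun _ w => f w) ?_
  intro Γ xs ys
  obtain ⟨M, hM⟩ := hf Γ ys
  exact ⟨M, fun ρ v w _ hw => hM ρ w hw⟩

theorem Definable.prec {n : ℕ} {f : List.Vector ℕ n → ℕ} {g : List.Vector ℕ (n + 2) → ℕ}
    (hf : Definable k f) (hg : Definable k g) :
    Definable k fun v : List.Vector ℕ (n + 1) =>
      v.head.rec (f v.tail) fun y IH => g (y ::ᵥ IH ::ᵥ v.tail) := by
  intro Γ xs
  let Δ : List Ty := Ty.nat :: Ty.arr Ty.nat Ty.nat :: Γ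
  obtain ⟨F, hF⟩ := hf Δ fun j => (xs j.succ).there.there
  obtain ⟨G, hG⟩ := hg (Ty.nat :: Ty.nat :: Δ) (Fin.cons (Var.there Var.here)
    (Fin.cons Var.here fun j => (xs j.succ).there.there.there.there))
  let y : Tm k Δ Ty.nat := Tm.var Var.here
  let IH : Tm k (Ty.nat :: Δ) Ty.nat :=
    Tm.app (Tm.var (Var.there (Var.there Var.here))) (Tm.var Var.here)
  -- The body of `Y (λ f. λ y. …)`. In the successor branch, two redexes bind the predecessor and
  -- then the recursive call on it, so that `G` finds both as variables.
  let C : Tm k Δ Ty.nat := Tm.ifz y F (Tm.app (Tm.lam (Tm.app (Tm.lam G) IH)) (Tm.pred y))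
  refine ⟨Tm.app (Tm.fix (Tm.lam (Tm.lam C))) (Tm.var (xs 0)), fun ρ v hv a => ?_⟩
  let r : ℕ → ℕ := fun y => y.rec (f v.tail) fun y IH => g (y ::ᵥ IH ::ᵥ v.tail)
  have hv' : Assigns ρ (fun j => xs j.succ) v.tail := fun j a => by
    simpa using hv j.succ a
  -- one unfolding of the recursion
  have step : ∀ (n c a : ℕ) (S : ℕ → Prop), (∀ b, S b ↔ b = c) →
      (SetApp (SetIter (C.lam.lam.sem ρ) (n + 1)) S a ↔
        (c = 0 ∧ a = f v.tail) ∨ (c ≠ 0 ∧ G.sem (envCons (fun b : ℕ =>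
          SetApp (SetIter (C.lam.lam.sem ρ) n) (fun e : ℕ => e = c - 1) b)
            (envCons (fun e : ℕ => e = c - 1) (envCons (fun e : ℕ => e = c)
              (envCons (SetIter (C.lam.lam.sem ρ) n) ρ)))) a)) := by
    intro n c a S hS
    obtain rfl : S = fun b => b = c := funext fun b => propext (hS b)
    have hy : ∀ b : ℕ, y.sem (envCons (fun e : ℕ => e = c)
        (envCons (SetIter (C.lam.lam.sem ρ) n) ρ)) b ↔ b = c := fun b => sem_var
    have hp : (Tm.pred y).sem (envCons (fun e : ℕ => e = c)
        (envCons (SetIter (C.lam.lam.sem ρ) n) ρ)) = fun b : ℕ => b = c - 1 := by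
      funext b
      refine propext (sem_pred.trans ?_)
      simp only [hy, exists_eq_left]
    refine setApp_setIter_succ.trans (sem_ifz.trans (or_congr (and_congr ?_ ?_)
      (and_congr ?_ (sem_app_lam.trans (sem_app_lam.trans ?_)))))
    · exact (hy 0).trans eq_comm
    · exact hF _ _ ((hv'.there _).there _) a
    · simp only [hy]
      exact ⟨fun ⟨m, hm⟩ => by omega, fun h => ⟨c - 1, by omega⟩⟩
    · rw [hp]
      have hIH : IH.sem (envCons (fun e : ℕ => e = c - 1) (envCons (fun e : ℕ => e = c)
          (envCons (SetIter (C.lam.lam.sem ρ) n) ρ))) = fun b : ℕ =>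
            SetApp (SetIter (C.lam.lam.sem ρ) n) (fun e : ℕ => e = c - 1) b := by
        funext b
        refine propext (sem_app.trans (exists_congr fun m => and_congr sem_var ?_))
        exact forall_congr' fun e => imp_congr_right fun _ => sem_var
      rw [hIH]
  -- Every approximant returns a subset of `{r c}`, possibly empty.
  have sound : ∀ (n c a : ℕ), SetApp (SetIter (C.lam.lam.sem ρ) n) (fun b : ℕ => b = c) a →
      a = r c := by
    intro n
    induction n with
    | zero => exact fun c a h => absurd h not_setApp_setIter_zero
    | succ n ih =>
      intro c a h
      rcases (step n c a _ fun _ => Iff.rfl).1 h with ⟨rfl, h'⟩ | ⟨hc, h'⟩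
      · exact h'
      · obtain ⟨c, rfl⟩ := Nat.exists_eq_succ_of_ne_zero hc
        -- `G` is specified only on singletons, so the set of recursive results is first enlarged to
        -- `{r c}` by monotonicity.
        refine (hG _ (c ::ᵥ r c ::ᵥ v.tail) ?_ a).1 (Tm.sem_mono h' (envCons_mono
          (H := fun b : ℕ => b = r c) fun b hb => ih c b hb))
        exact Assigns.cons (fun _ => Iff.rfl) (Assigns.cons (fun _ => Iff.rfl) hv')
  -- The approximant of index 0 is empty, and computing `r c` takes `c + 1` unfoldings.
  have complete : ∀ c n : ℕ, c < n →
      SetApp (SetIter (C.lam.lam.sem ρ) n) (fun b : ℕ => b = c) (r c) := by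
    intro c
    induction c with
    | zero =>
      rintro (_ | n) h
      · omega
      · exact (step n 0 _ _ fun _ => Iff.rfl).2 (Or.inl ⟨rfl, rfl⟩)
    | succ c ih =>
      rintro (_ | n) h
      · omega
      · refine (step n (c + 1) _ _ fun _ => Iff.rfl).2 (Or.inr ⟨by omega, ?_⟩)
        refine (hG _ (c ::ᵥ r c ::ᵥ v.tail) ?_ _).2 rfl
        refine Assigns.cons (fun _ => Iff.rfl) (Assigns.cons (fun b => ?_) hv')
        exact ⟨fun h => sound n c b h, fun h => h ▸ ih n (by omega)⟩
  have harg : (Tm.var (k := k) (xs 0)).sem ρ = fun b : ℕ => b = v.head := by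
    funext b
    exact propext (sem_var.trans (by simpa using hv 0 b))
  refine sem_app_fix_lam_lam.trans ?_
  rw [harg]
  exact ⟨fun ⟨n, h⟩ => sound n _ a h, fun h => ⟨v.head + 1, h ▸ complete v.head _ (by omega)⟩⟩

theorem definable_of_primrec' {n : ℕ} {f : List.Vector ℕ n → ℕ} (hf : Nat.Primrec' f) :
    Definable k f := by
  induction hf with
  | zero => exact fun Γ _ => ⟨Tm.zero, fun ρ v _ a => sem_zero⟩
  | succ =>
    refine fun Γ xs => ⟨Tm.succ (Tm.var (xs 0)), fun ρ v hv a => sem_succ.trans ?_⟩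
    have h : ∀ m : ℕ, (Tm.var (k := k) (xs 0)).sem ρ m ↔ m = v.head := fun m =>
      sem_var.trans (by simpa using hv 0 m)
    simp only [h, exists_eq_left]
  | get j => exact fun Γ xs => ⟨Tm.var (xs j), fun ρ v hv a => sem_var.trans (hv j a)⟩
  | comp g _ _ ihf ihg => exact ihf.comp ihg
  | prec _ _ ihf ihg => exact ihf.prec ihg

end PCFX
end

noncomputable section

namespace PCFX

/-! ### Semi-decision procedures as terms -/

/-- Evaluation of a code with bound `t` is primitive recursive, and the code converges exactly when
some bound suffices. -/
theorem exists_primrec'_of_rePred {p : ℕ → Prop} (hp : REPred p) :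
    ∃ f : List.Vector ℕ 2 → ℕ, Nat.Primrec' f ∧
      ∀ n, p n ↔ ∃ t, f (t ::ᵥ n ::ᵥ List.Vector.nil) = 0 := by
  obtain ⟨c, hc⟩ := Nat.Partrec.Code.exists_code.1 hp
  have hdom : ∀ n, p n ↔ (c.eval n).Dom := fun n => by
    rw [hc]
    simp [Part.assert]
  -- The value 0 signals convergence, so that `ifz` stops the search there.
  let g : ℕ → ℕ → ℕ := fun t n => Option.casesOn (c.evaln t n) 1 fun _ => 0
  have hg : Primrec₂ g := by
    refine Primrec.option_casesOn (o := fun q : ℕ × ℕ => c.evaln q.1 q.2) ?_ (Primrec.const 1)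
      (Primrec.const 0).to₂
    exact Nat.Partrec.Code.primrec_evaln.comp
      ((Primrec.fst.pair (Primrec.const c)).pair Primrec.snd)
  refine ⟨_, Nat.Primrec'.prim_iff₂.2 hg, fun n => ?_⟩
  rw [hdom, Part.dom_iff_mem]
  simp only [Nat.Partrec.Code.evaln_complete]
  rw [exists_comm]
  refine exists_congr fun t => ?_
  change _ ↔ g t n = 0
  cases h : c.evaln t n <;> simp [g, h]

variable {k : ℕ}

/-- The Boolean constant `i`. -/
def boolTm (k : ℕ) (Γ : List Ty) (i : Fin 2) : Tm k Γ Ty.bool :=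
  if i = 0 then Tm.bool0 else Tm.bool1

theorem interp_boolTm (Γ : List Ty) (i j : Fin 2) :
    (boolTm k Γ i).interp j = if j = i then 1 else 0 := by
  fin_cases i <;> rfl

theorem sem_boolTm_self {Γ : List Ty} {ρ : FVar k Γ → Prop} (i : Fin 2) :
    (boolTm k Γ i).sem ρ i := by
  unfold Tm.sem
  rw [interp_boolTm, if_pos rfl]
  exact holds_one

/-- Unbounded search for a zero of a definable function. -/
theorem exists_search {f : List.Vector ℕ 2 → ℕ} (hf : Definable k f) (i : Fin 2) :
    ∃ U : Tm k [Ty.nat] Ty.bool, ∀ (ρ : FVar k [] → Prop) (n : ℕ),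
      U.sem (envCons (fun a : ℕ => a = n) ρ) i ↔ ∃ t, f (t ::ᵥ n ::ᵥ List.Vector.nil) = 0 := by
  let Δ : List Ty := [Ty.nat, Ty.arr Ty.nat Ty.bool, Ty.nat]
  obtain ⟨F, hF⟩ := hf Δ (Fin.cons Var.here (Fin.cons (Var.there (Var.there Var.here)) Fin.elim0))
  -- The loop body at counter `t`: answer `i` if `f` vanishes at `t`, otherwise call the loop on `t
  -- + 1`.
  let C : Tm k Δ Ty.bool := Tm.ifz F (boolTm k Δ i)
    (Tm.app (Tm.var (Var.there Var.here)) (Tm.succ (Tm.var Var.here)))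
  refine ⟨Tm.app (Tm.fix (Tm.lam (Tm.lam C))) Tm.zero, fun ρ₀ n => ?_⟩
  set ρ : FVar k [Ty.nat] → Prop := envCons (fun a : ℕ => a = n) ρ₀ with hρ
  -- The approximant of index `N`, started at `t`, tests exactly the values `t, …, t + N - 1`.
  have key : ∀ N t : ℕ, SetApp (SetIter (C.lam.lam.sem ρ) N) (fun a : ℕ => a = t) i ↔
      ∃ s < N, f ((t + s) ::ᵥ n ::ᵥ List.Vector.nil) = 0 := by
    intro N
    induction N with
    | zero => exact fun t => iff_of_false not_setApp_setIter_zero (by simp)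
    | succ N ih =>
      intro t
      have hFt : ∀ a : ℕ, F.sem (envCons (fun a : ℕ => a = t)
          (envCons (SetIter (C.lam.lam.sem ρ) N) ρ)) a ↔
            a = f (t ::ᵥ n ::ᵥ List.Vector.nil) :=
        hF _ _ (Assigns.cons (fun _ => Iff.rfl) (Assigns.cons (fun _ => Iff.rfl)
          fun j => j.elim0))
      have hcall : (Tm.app (Tm.var (Var.there Var.here)) (Tm.succ (Tm.var Var.here)) :
          Tm k Δ Ty.bool).sem (envCons (fun a : ℕ => a = t)
            (envCons (SetIter (C.lam.lam.sem ρ) N) ρ)) i ↔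
              ∃ s < N, f ((t + 1 + s) ::ᵥ n ::ᵥ List.Vector.nil) = 0 := by
        rw [← ih]
        refine sem_app.trans (exists_congr fun m => and_congr sem_var ?_)
        refine forall_congr' fun e => imp_congr_right fun _ => sem_succ.trans ?_
        constructor
        · rintro ⟨b, hb, rfl⟩
          exact congrArg (· + 1) (sem_var.1 hb)
        · rintro rfl
          exact ⟨t, sem_var.2 rfl, rfl⟩
      refine setApp_setIter_succ.trans (sem_ifz.trans ?_)
      rw [hcall, hFt, and_iff_left (sem_boolTm_self i)]
      simp only [hFt]
      constructor
      · rintro (h | ⟨-, s, hs, h⟩)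
        · exact ⟨0, by omega, h.symm⟩
        · exact ⟨s + 1, by omega, by rwa [← add_assoc, add_right_comm]⟩
      · rintro ⟨s, hs, h⟩
        rcases Nat.eq_zero_or_pos (f (t ::ᵥ n ::ᵥ List.Vector.nil)) with h0 | h0
        · exact Or.inl h0.symm
        · refine Or.inr ⟨⟨f (t ::ᵥ n ::ᵥ List.Vector.nil) - 1, by omega⟩, ?_⟩
          cases s with
          | zero => exact absurd h h0.ne'
          | succ s => exact ⟨s, by omega, by rwa [add_right_comm, add_assoc]⟩
  have harg : (Tm.zero (k := k) (Γ := [Ty.nat])).sem ρ = fun b : ℕ => b = 0 :=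
    funext fun b => propext sem_zero
  refine sem_app_fix_lam_lam.trans ?_
  rw [harg]
  simp only [key, zero_add]
  exact ⟨fun ⟨_, s, _, h⟩ => ⟨s, h⟩, fun ⟨s, h⟩ => ⟨s + 1, s, by omega, h⟩⟩

/-- The numeral `n`. -/
def numeral (k : ℕ) (Γ : List Ty) : ℕ → Tm k Γ Ty.nat
  | 0 => Tm.zero
  | n + 1 => Tm.succ (numeral k Γ n)

theorem sem_numeral {Γ : List Ty} {ρ : FVar k Γ → Prop} (n a : ℕ) :
    (numeral k Γ n).sem ρ a ↔ a = n := by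
  induction n generalizing a with
  | zero => exact sem_zero
  | succ n ih =>
    refine sem_succ.trans ?_
    simp only [ih, exists_eq_left]

theorem primrec_numeral_code (Γ : List Ty) : Primrec fun n => (numeral k Γ n).code := by
  refine (Primrec.nat_rec₁ (Nat.pair 0 0) (f := fun _ c => Nat.pair 1 c)
    (Primrec₂.natPair.comp (Primrec.const 1) Primrec.snd).to₂).of_eq fun n => ?_
  induction n with
  | zero => rfl
  | succ n ih => exact congrArg (Nat.pair 1) ih

/-- Every recursively enumerable predicate is semi-decided, uniformly, by closed terms of type
`Bool` that may only converge to `i`. -/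
theorem exists_semidecision {p : ℕ → Prop} (hp : REPred p) (i : Fin 2) :
    ∃ T : ℕ → Tm k [] Ty.bool, (Primrec fun n => (T n).code) ∧
      ∀ n ρ, (T n).sem ρ i ↔ p n := by
  obtain ⟨f, hf, hpf⟩ := exists_primrec'_of_rePred hp
  obtain ⟨U, hU⟩ := exists_search (k := k) (definable_of_primrec' hf) i
  refine ⟨fun n => Tm.app (Tm.lam U) (numeral k [] n), ?_, fun n ρ => ?_⟩
  -- `U` does not depend on `n`: only the code of the numeral varies.
  · exact Primrec₂.natPair.comp (Primrec.const _) (Primrec₂.natPair.comp (Primrec.const _)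
      (Primrec₂.natPair.comp (Primrec.const _) (primrec_numeral_code _)))
  · have hn : (numeral k [] n).sem ρ = fun a : ℕ => a = n :=
      funext fun a => propext (sem_numeral n a)
    refine sem_app_lam.trans ?_
    rw [hn, hU, hpf]

/-! ### The tropical degree of series with a linear monomial -/

instance : Nontrivial Trop :=
  ⟨0, 1, fun h => ENNReal.top_ne_zero (congrArg Tropical.untrop h)⟩

instance : NoZeroDivisors Trop :=
  ⟨fun {a b} h => by
    have h' : Tropical.untrop a + Tropical.untrop b = ⊤ := congrArg Tropical.untrop h
    exact (ENNReal.add_eq_top.1 h').imp (fun h => Tropical.untrop_injective h)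
      (fun h => Tropical.untrop_injective h)⟩

/-- The zero of `Trop` is `∞`, and an infimum is finite as soon as one term is. At points with
coordinates `0` and `1`, evaluation therefore detects which variables the monomials avoid. -/
theorem evalTrop_ne_zero {V : Type} (s : MvPowerSeries V Trop) (x : V → Trop) :
    evalTrop s x ≠ 0 ↔ ∃ μ ∈ FPS.supp s, (μ.prod fun a n => x a ^ n) ≠ 0 := by
  have hz : ∀ y : Trop, y ≠ 0 ↔ Tropical.untrop y ≠ ⊤ := fun y =>
    not_congr Tropical.untrop_injective.eq_iff.symm
  rw [hz, evalTrop, Tropical.untrop_trop, Ne, iInf_eq_top, not_forall]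
  refine exists_congr fun μ => ?_
  rw [← Ne, ← hz, mul_ne_zero_iff]
  rfl

theorem supp_tropSeries {V : Type} (s : FPS V) : FPS.supp (tropSeries s) = FPS.supp s := by
  classical
  ext μ
  change (if μ ∈ FPS.supp s then (1 : Trop) else 0) ≠ 0 ↔ _
  split_ifs with h <;> simp [h]

/-- If `v` divides every monomial, the linear monomial dominates and `X v` represents the function.
Otherwise a representing polynomial needs a monomial avoiding `v`, and all of those have degree at
least 2. -/
theorem sInf_degreeSet_of_linear {V : Type} [Finite V] {s : FPS V} {v : V}
    (hv : Finsupp.single v 1 ∈ FPS.supp s)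
    (hs : ∀ μ ∈ FPS.supp s, μ = Finsupp.single v 1 ∨ 2 ≤ μ.sum fun _ e => e) :
    (sInf (degreeSet s) = 1 ↔ ∀ μ ∈ FPS.supp s, μ v ≠ 0) ∧
      (sInf (degreeSet s) < 2 ↔ ∀ μ ∈ FPS.supp s, μ v ≠ 0) := by
  classical
  have hdeg : ∀ {p : MvPolynomial V Trop} {μ : V →₀ ℕ},
      μ ∈ FPS.supp (p : MvPowerSeries V Trop) → (μ.sum fun _ e => e) ≤ p.totalDegree := by
    intro p μ hμ
    refine MvPolynomial.le_totalDegree (MvPolynomial.mem_support_iff.2 ?_)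
    rwa [FPS.supp, Set.mem_ofPred_eq, MvPolynomial.coeff_coe] at hμ
  have hpos : 1 ≤ sInf (degreeSet s) := by
    refine le_csInf (degreeSet_nonempty s) ?_
    rintro _ ⟨p, -, hp, hsub, rfl⟩
    -- At the point with all coordinates the real number 0 the function is finite, so `p` has a
    -- monomial, and no monomial of `s` is constant.
    have h1 : evalTrop (tropSeries s) 1 ≠ 0 :=
      (evalTrop_ne_zero _ _).2 ⟨_, (supp_tropSeries s).symm ▸ hv, by simp⟩
    rw [← hp] at h1
    obtain ⟨μ, hμ, -⟩ := (evalTrop_ne_zero _ _).1 h1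
    refine le_trans ?_ (hdeg hμ)
    rcases hs μ (hsub hμ) with rfl | h
    · simp
    · omega
  have hle : (∀ μ ∈ FPS.supp s, μ v ≠ 0) → sInf (degreeSet s) ≤ 1 := by
    intro h
    have hX : ∀ μ, MvPolynomial.coeff μ (MvPolynomial.X v : MvPolynomial V Trop) =
        if Finsupp.single v 1 = μ then 1 else 0 := fun μ => MvPolynomial.coeff_X _ _
    refine Nat.sInf_le ⟨MvPolynomial.X v, fun μ => ?_, ?_, fun μ hμ => ?_,
      MvPolynomial.totalDegree_X v⟩
    · rw [hX]
      split_ifs <;> simp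
    · funext x
      unfold evalTrop
      refine congrArg Tropical.trop (le_antisymm ?_ ?_)
      · refine le_iInf fun μ => ?_
        change _ ≤ Tropical.untrop ((if μ ∈ FPS.supp s then (1 : Trop) else 0) * _)
        split_ifs with hμ
        · refine (iInf_le _ (Finsupp.single v 1)).trans ?_
          rw [MvPolynomial.coeff_coe, hX, if_pos rfl, one_mul, one_mul]
          refine evalTrop_anti x (Finsupp.single_le_iff.2 ?_)
          exact Nat.one_le_iff_ne_zero.2 (h μ hμ)
        · simp
      · refine le_iInf fun μ => ?_
        rw [MvPolynomial.coeff_coe, hX]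
        split_ifs with hμ
        · refine (iInf_le _ μ).trans (le_of_eq ?_)
          subst hμ
          change Tropical.untrop ((if _ ∈ FPS.supp s then (1 : Trop) else 0) * _) = _
          rw [if_pos hv]
        · simp
    · rw [FPS.supp, Set.mem_ofPred_eq, MvPolynomial.coeff_coe, hX] at hμ
      obtain rfl : Finsupp.single v 1 = μ := by
        by_contra hne
        simp [hne] at hμ
      exact hv
  have hge : sInf (degreeSet s) < 2 → ∀ μ ∈ FPS.supp s, μ v ≠ 0 := by
    intro hlt μ hμ hμv
    obtain ⟨p, -, hp, hsub, hdp⟩ := Nat.sInf_mem (degreeSet_nonempty s)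
    -- The coordinate `v` is `∞` and the others are the real number 0, which kills exactly the
    -- monomials containing `v`.
    let x : V → Trop := fun a => if a = v then 0 else 1
    have hx : ∀ ν : V →₀ ℕ, (ν.prod fun a n => x a ^ n) ≠ 0 ↔ ν v = 0 := by
      intro ν
      rw [Finsupp.prod, Finset.prod_ne_zero_iff]
      constructor
      · intro h
        by_contra hne
        exact h v (Finsupp.mem_support_iff.2 hne) (by simp [x, hne])
      · intro h a ha
        have hav : a ≠ v := by
          rintro rfl
          exact Finsupp.mem_support_iff.1 ha h
        simp [x, hav]
    have h1 : evalTrop (tropSeries s) x ≠ 0 :=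
      (evalTrop_ne_zero _ _).2 ⟨μ, (supp_tropSeries s).symm ▸ hμ, (hx μ).2 hμv⟩
    rw [← hp] at h1
    obtain ⟨ν, hν, hνx⟩ := (evalTrop_ne_zero _ _).1 h1
    have hνv := (hx ν).1 hνx
    have := hdeg hν
    rcases hs ν (hsub hν) with rfl | h
    · simp at hνv
    · omega
  exact ⟨⟨fun h => hge (by omega), fun h => le_antisymm (hle h) hpos⟩,
    ⟨hge, fun h => Nat.lt_succ_of_le (hle h)⟩⟩

/-! ### The reduction -/

/-- The term `i ⊕ ((1 - i) ⊕ T)`, for the parameter `X_j`. -/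
def gadget (j : Fin k) (i : Fin 2) (T : Tm k [] Ty.bool) : Tm k [] Ty.bool :=
  Tm.choice j (boolTm k [] i) (Tm.choice j (boolTm k [] (1 - i)) T)

theorem series_boolTm (i j : Fin 2) :
    (boolTm k [] i).series j = if j = i then 1 else 0 :=
  interp_boolTm [] i j

theorem series_choice (j : Fin k) (M N : Tm k [] Ty.bool) (i : Fin 2) :
    (Tm.choice j M N).series i = (MvPowerSeries.X (j, true) : FPS (Param k)) * M.series i +
      (MvPowerSeries.X (j, false) : FPS (Param k)) * N.series i :=
  rfl

/-- The constant `1 - i` contributes nothing at `i`; it is there to guard `T` by `X̄²`, so that even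
a constant monomial of `T` yields degree 2. -/
theorem series_gadget (j : Fin k) (i : Fin 2) (T : Tm k [] Ty.bool) :
    (gadget j i T).series i = (MvPowerSeries.X (j, true) : FPS (Param k)) +
      (MvPowerSeries.X (j, false) : FPS (Param k)) *
        ((MvPowerSeries.X (j, false) : FPS (Param k)) * T.series i) := by
  have h : i ≠ 1 - i := by fin_cases i <;> decide
  rw [gadget, series_choice, series_choice, series_boolTm, series_boolTm, if_pos rfl, if_neg h,
    mul_one, mul_zero, zero_add]

theorem mem_supp_X {V : Type} {v : V} {μ : V →₀ ℕ} :
    μ ∈ FPS.supp (MvPowerSeries.X v : FPS V) ↔ μ = Finsupp.single v 1 := by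
  classical
  rw [FPS.supp, Set.mem_ofPred_eq, MvPowerSeries.coeff_X]
  simp

theorem mem_supp_series_gadget {j : Fin k} {i : Fin 2} {T : Tm k [] Ty.bool}
    {μ : Param k →₀ ℕ} : μ ∈ FPS.supp ((gadget j i T).series i) ↔
      μ = Finsupp.single (j, true) 1 ∨
        ∃ ν ∈ FPS.supp (T.series i), μ = Finsupp.single (j, false) 2 + ν := by
  have hadd : ∀ s t : FPS (Param k), μ ∈ FPS.supp (s + t) ↔ μ ∈ FPS.supp s ∨ μ ∈ FPS.supp t :=
    fun s t => by simp only [FPS.supp, Set.mem_ofPred_eq, map_add, Ne, add_eq_zero, not_and_or]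
  rw [series_gadget, hadd, mem_supp_X]
  simp only [mem_supp_mul, mem_supp_X]
  refine or_congr Iff.rfl ?_
  constructor
  · rintro ⟨_, rfl, _, ⟨_, rfl, ν, hν, rfl⟩, rfl⟩
    exact ⟨ν, hν, by rw [← add_assoc, ← Finsupp.single_add]⟩
  · rintro ⟨ν, hν, rfl⟩
    exact ⟨_, rfl, _, ⟨_, rfl, ν, hν, rfl⟩, by rw [← add_assoc, ← Finsupp.single_add]⟩

theorem tropDegree_gadget (j : Fin k) {i : Fin 2} {T : Tm k [] Ty.bool} {q : Prop}
    (hT : ∀ ρ, T.sem ρ i ↔ q) :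
    ((gadget j i T).tropDegree i = 1 ↔ ¬ q) ∧ ((gadget j i T).tropDegree i < 2 ↔ ¬ q) := by
  have key : (∀ μ ∈ FPS.supp ((gadget j i T).series i), μ (j, true) ≠ 0) ↔ ¬ q := by
    constructor
    · intro h hq
      -- With all parameters false, the witnessing monomial of `T` involves none of them.
      obtain ⟨(ν : Param k →₀ ℕ), hν, hν'⟩ := (hT fun _ => False).2 hq
      have h0 : ν (j, true) = 0 := by_contra fun hne => hν' _ hne
      refine h _ (mem_supp_series_gadget.2 (Or.inr ⟨ν, hν, rfl⟩)) ?_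
      rw [Finsupp.add_apply, h0]
      simp
    · intro hq μ hμ
      rcases mem_supp_series_gadget.1 hμ with rfl | ⟨ν, hν, -⟩
      · simp
      -- With all parameters true, any monomial of `T` at all would force `q`.
      · exact absurd ((hT fun _ => True).1 ⟨ν, hν, fun _ _ => trivial⟩) hq
  rw [← key]
  refine sInf_degreeSet_of_linear (mem_supp_series_gadget.2 (Or.inl rfl)) fun μ hμ => ?_
  refine (mem_supp_series_gadget.1 hμ).imp id ?_
  rintro ⟨ν, -, rfl⟩
  rw [Finsupp.sum_add_index' (fun _ => rfl) (fun _ _ _ => rfl), Finsupp.sum_single_index rfl]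
  omega

/-- A semi-decision procedure for the problem would pull back along the reduction to one for
non-halting. -/
theorem ProblemPi01Hard.not_problemRE {ι : Type} {code : ι → ℕ} {yes : ι → Prop}
    (h : ProblemPi01Hard code yes) : ¬ ProblemRE code yes := by
  rintro ⟨P, hP, hPy⟩
  let q : ℕ → Prop := fun n => (Nat.Partrec.Code.eval (Denumerable.ofNat _ n) 0).Dom
  have hq : REPred q :=
    Partrec.comp (ComputablePred.halting_problem_re 0) (Computable.ofNat Nat.Partrec.Code)
  obtain ⟨f, hf, hfy⟩ := h (fun n => ¬ q n) (hq.of_eq fun n => not_not.symm)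
  refine ComputablePred.halting_problem_not_re 0 ?_
  refine REPred.of_eq (p := fun c : Nat.Partrec.Code => P (code (f (Encodable.encode c))))
    (Partrec.comp hP (hf.comp Computable.encode)) fun c => ?_
  rw [hPy, ← hfy]
  simp [q]

/-- A decision problem about degrees is `Π⁰₁`-hard if it separates, for a fixed `d`, the two
degrees of the terms `gadget`. -/
theorem problemPi01Hard_of_gadget (j : Fin k) (i : Fin 2) (d : ℕ)
    {yes : ℕ × Tm k [] Ty.bool → Prop}
    (hyes : ∀ (T : Tm k [] Ty.bool) (q : Prop), (∀ ρ, T.sem ρ i ↔ q) →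
      (yes (d, gadget j i T) ↔ ¬ q)) : ProblemPi01Hard instanceCode yes := by
  intro A hA
  obtain ⟨T, hTc, hT⟩ := exists_semidecision (k := k) hA i
  refine ⟨fun n => (d, gadget j i (T n)), Primrec.to_comp ?_, fun n => ?_⟩
  · have hpair : ∀ (c : ℕ) {g : ℕ → ℕ}, Primrec g → Primrec fun n => Nat.pair c (g n) :=
      fun c g hg => Primrec₂.natPair.comp (Primrec.const c) hg
    -- Seven pairings surround the code of `T n`: one for `d`, and three for each `choice` (its tag,
    -- the index `j`, its left branch).
    exact hpair _ (hpair _ (hpair _ (hpair _ (hpair _ (hpair _ (hpair _ hTc))))))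
  · rw [hyes (T n) _ (hT n), not_not]

end PCFX
end

theorem mainTheorem3 (k : ℕ) (hk : 2 ≤ k) (i : Fin 2) :
    (¬ PCFX.ProblemRE PCFX.instanceCode
        (fun x : ℕ × PCFX.Tm k [] PCFX.Ty.bool => x.2.tropDegree i < x.1) ∧
      PCFX.ProblemPi01Hard PCFX.instanceCode
        (fun x : ℕ × PCFX.Tm k [] PCFX.Ty.bool => x.2.tropDegree i < x.1)) ∧
    (¬ PCFX.ProblemRE PCFX.instanceCode
        (fun x : ℕ × PCFX.Tm k [] PCFX.Ty.bool => x.2.tropDegree i = x.1) ∧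
      PCFX.ProblemPi01Hard PCFX.instanceCode
        (fun x : ℕ × PCFX.Tm k [] PCFX.Ty.bool => x.2.tropDegree i = x.1)) := by
  -- The fixed thresholds are `d = 2` for the inequality and `d = 1` for the equality; a single
  -- parameter suffices for the reduction.
  have hlt := PCFX.problemPi01Hard_of_gadget (yes := fun x => x.2.tropDegree i < x.1)
    (⟨0, by omega⟩ : Fin k) i 2 fun _ _ hT => (PCFX.tropDegree_gadget _ hT).2
  have heq := PCFX.problemPi01Hard_of_gadget (yes := fun x => x.2.tropDegree i = x.1)
    (⟨0, by omega⟩ : Fin k) i 1 fun _ _ hT => (PCFX.tropDegree_gadget _ hT).1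
  exact ⟨⟨hlt.not_problemRE, hlt⟩, heq.not_problemRE, heq⟩
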